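/- Let $G$ be a locally compact abelian (Hausdorff) group, written additively. A group compactification of $G$ is a pair $(\iota_X,X)$ consisting of a compact Hausdorff topological group $X$ and a continuous homomorphism $\iota_X:G\to X$ with dense image; $\mu_X$ denotes the Haar measure on $X$ with $\mu_X(X)=1$. The Bohr compactification $(\iota_b,bG)$ of $G$ is given by $\iota_b(g)=(\chi(g))_{\chi\in\hat G}$ and $bG=\overline{\iota_b(G)}\subseteq\mathbb{T}^{\hat G}$, where $\hat G$ is the group of all continuous homomorphisms $\chi:G\to\mathbb{T}=\mathbb{R}/\mathbb{Z}$. A function $\phi:G\to\mathbb{C}$ is almost periodic if $\phi=\phi_b\circ\iota_b$ for some continuous $\phi_b:bG\to\mathbb{C}$. A function $\phi^*:X\to\mathbb{C}$ on a group compactification $(\iota_X,X)$ is a realization of $\phi$ if $\phi^*$ is Riemann integrable (bounded, with a $\mu_X$-null set of points of discontinuity) and $\phi=\phi^*\circ\iota_X$ everywhere on $G$; it is an aperiodic realization if in addition $$\Big\{x\in X:\ \int_X|\phi^*(y)-\phi^*(x+y)|\,d\mu_X(y)=0\Big\}=\{0_X\}.$$ Corollary. For every almost periodic function $\phi:G\to\mathbb{C}$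 there are a group compactification $(\iota_X,X)$ of $G$ and a continuous function $\phi^*:X\to\mathbb{C}$ which is an aperiodic realization of $\phi$. -/

import Mathlib

open MeasureTheory

universe u

/-- A group compactification `(ι, X)` of the topological abelian group `G`: a compact Hausdorff
topological group `X` and a continuous homomorphism `ι : G → X` with dense image. (A Hausdorff
group with a dense abelian subgroup is abelian, so `X` is taken abelian.) -/
structure GroupCompactification (G : Type u) [AddCommGroup G] [TopologicalSpace G] where
  X : Type u
  [addCommGroup : AddCommGroup X]
  [topologicalSpace : TopologicalSpace X]
  [isTopologicalAddGroup : IsTopologicalAddGroup X]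
  [compactSpace : CompactSpace X]
  [t2Space : T2Space X]
  ι : G →ₜ+ X
  denseRange : DenseRange ι

namespace GroupCompactification

attribute [instance] addCommGroup topologicalSpace isTopologicalAddGroup compactSpace t2Space

variable {G : Type u} [AddCommGroup G] [TopologicalSpace G]

instance (C : GroupCompactification G) : MeasurableSpace C.X := borel C.X

instance (C : GroupCompactification G) : BorelSpace C.X := ⟨rfl⟩

/-- The Haar measure `μ_X` on `X`, normalized by `μ_X(X) = 1`. -/
noncomputable def haar (C : GroupCompactification G) : Measure C.X :=
  Measure.addHaarMeasure (⊤ : TopologicalSpace.PositiveCompacts C.X)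

/-- `f ∈ R(X)`: `f` is bounded and its set of points of discontinuity is a `μ_X`-null set. -/
def RiemannIntegrable (C : GroupCompactification G) (f : C.X → ℂ) : Prop :=
  (∃ M : ℝ, ∀ x, ‖f x‖ ≤ M) ∧ C.haar {x | ¬ ContinuousAt f x} = 0

/-- `f` realizes `φ` on `(ι, X)`: `f` is Riemann integrable and `φ = f ∘ ι` everywhere on `G`. -/
def Realizes (C : GroupCompactification G) (f : C.X → ℂ) (φ : G → ℂ) : Prop :=
  C.RiemannIntegrable f ∧ φ = f ∘ C.ι

/-- `d_f(x) = ‖f - τ_x f‖₁`, the `L¹(μ_X)`-distance of `f` from its translate by `x`. -/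
noncomputable def transDist (C : GroupCompactification G) (f : C.X → ℂ) (x : C.X) : ENNReal :=
  eLpNorm (fun y => f y - f (x + y)) 1 C.haar

/-- `f` is an aperiodic realization of `φ`: it realizes `φ`, and `ker d_f = {0}`. -/
def IsAperiodicRealization (C : GroupCompactification G) (f : C.X → ℂ) (φ : G → ℂ) : Prop :=
  C.Realizes f φ ∧ {x : C.X | C.transDist f x = 0} = {0}

end GroupCompactification

section Bohr

variable (G : Type u) [AddCommGroup G] [TopologicalSpace G]

/-- The homomorphism `g ↦ (χ(g))_χ` from `G` to the product of copies of `𝕋 = ℝ/ℤ` indexed by all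
continuous characters `χ : G → 𝕋`. -/
def bohrHom : G →ₜ+ ((G →ₜ+ UnitAddCircle) → UnitAddCircle) where
  toFun g χ := χ g
  map_zero' := funext fun χ => map_zero χ
  map_add' g h := funext fun χ => map_add χ g h
  continuous_toFun := continuous_pi fun χ => χ.continuous_toFun

/-- The group `bG`: the closure of the image of `G` under `g ↦ (χ(g))_χ`. -/
def bohrSubgroup : AddSubgroup ((G →ₜ+ UnitAddCircle) → UnitAddCircle) :=
  (bohrHom G : G →+ ((G →ₜ+ UnitAddCircle) → UnitAddCircle)).range.topologicalClosure

theorem bohrHom_mem (g : G) : bohrHom G g ∈ bohrSubgroup G :=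
  subset_closure ⟨g, rfl⟩

instance : CompactSpace (bohrSubgroup G) :=
  isCompact_iff_compactSpace.mp (isClosed_closure.isCompact)

/-- The canonical homomorphism `ι_b : G → bG`. -/
def bohrι : G →ₜ+ bohrSubgroup G where
  toFun g := ⟨bohrHom G g, bohrHom_mem G g⟩
  map_zero' := Subtype.ext (map_zero (bohrHom G))
  map_add' g h := Subtype.ext (map_add (bohrHom G) g h)
  continuous_toFun := (bohrHom G).continuous_toFun.subtype_mk _

theorem bohrι_denseRange : DenseRange (bohrι G) := by
  rintro ⟨x, hx⟩
  rw [closure_subtype, ← Set.range_comp]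
  exact hx

/-- The Bohr compactification `(ι_b, bG)` of the locally compact abelian group `G`, that is, the
group compactification of `G` induced by the group of all its continuous characters. -/
def bohrCompactification : GroupCompactification G where
  X := bohrSubgroup G
  ι := bohrι G
  denseRange := bohrι_denseRange G

end Bohr

/-- `φ ∈ AP(G)`: `φ` extends to a continuous function on the Bohr compactification, that is,
`φ = f ∘ ι_b` with `f : bG → ℂ` continuous. -/
def IsAlmostPeriodic {G : Type u} [AddCommGroup G] [TopologicalSpace G] (φ : G → ℂ) : Prop :=
  ∃ f : (bohrCompactification G).X → ℂ, Continuous f ∧ φ = f ∘ (bohrCompactification G).ι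

namespace GroupCompactification

variable {G : Type u} [AddCommGroup G] [TopologicalSpace G]

/-! For continuous `f` on a compactification, the kernel of `transDist` is exactly the group of
periods of `f`, because Haar measure charges every nonempty open set. This group is closed, so
dividing by it gives another compactification, to which `f` descends continuously; a period of the
descended function lifts to a period of `f` and is therefore zero. The theorem is the case of the
Bohr compactification. -/

instance (C : GroupCompactification G) : C.haar.IsAddHaarMeasure := by
  unfold haar; infer_instance

/-- The `L¹`-distance of a continuous function from a translate vanishes only if the two agree. -/
theorem transDist_eq_zero_iff (C : GroupCompactification G) {f : C.X → ℂ} (hf : Continuous f)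
    (x : C.X) : C.transDist f x = 0 ↔ ∀ y, f (x + y) = f y := by
  have ht : Continuous fun y => f (x + y) := hf.comp (continuous_const.add continuous_id)
  have hd : Continuous fun y => f y - f (x + y) := hf.sub ht
  -- A continuous function vanishing almost everywhere vanishes identically, as Haar measure has
  -- full support.
  rw [transDist, eLpNorm_eq_zero_iff hd.aestronglyMeasurable one_ne_zero,
    hd.ae_eq_iff_eq C.haar continuous_zero, funext_iff]
  exact forall_congr' fun y => sub_eq_zero.trans eq_comm

/-- A continuous function on a group compactification is Riemann integrable. -/
theorem riemannIntegrable_of_continuous (C : GroupCompactification G) {f : C.X → ℂ}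
    (hf : Continuous f) : C.RiemannIntegrable f := by
  constructor
  · obtain ⟨M, hM⟩ := isCompact_univ.exists_bound_of_continuousOn hf.continuousOn
    exact ⟨M, fun x => hM x trivial⟩
  · simp [hf.continuousAt]

/-- The subgroup of periods of a function on a group compactification. -/
def periods (C : GroupCompactification G) (f : C.X → ℂ) : AddSubgroup C.X where
  carrier := {x | ∀ y, f (x + y) = f y}
  zero_mem' y := by rw [zero_add]
  add_mem' {a b} ha hb y := by rw [add_assoc, ha, hb]
  neg_mem' {a} ha y := by rw [← ha (-a + y), add_neg_cancel_left]

/-- Needed for the quotient by the periods to be Hausdorff. -/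
theorem isClosed_periods (C : GroupCompactification G) {f : C.X → ℂ} (hf : Continuous f) :
    IsClosed (C.periods f : Set C.X) := by
  have h : (C.periods f : Set C.X) = ⋂ y, {x | f (x + y) = f y} := by
    ext x; simp [periods]
  rw [h]
  exact isClosed_iInter fun y =>
    isClosed_eq (hf.comp (continuous_id.add continuous_const)) continuous_const

/-- The quotient of a group compactification by a closed subgroup. -/
def quotient (C : GroupCompactification G) (K : AddSubgroup C.X) (hK : IsClosed (K : Set C.X)) :
    GroupCompactification G where
  X := C.X ⧸ K
  t2Space := by
    have := hK
    infer_instance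
  ι :=
    { toFun := fun g => (C.ι g : C.X ⧸ K)
      map_zero' := by rw [map_zero]; rfl
      map_add' := fun g h => by rw [map_add]; rfl
      continuous_toFun := continuous_quotient_mk'.comp C.ι.continuous_toFun }
  denseRange := (QuotientAddGroup.mk_surjective (s := K)).denseRange.comp C.denseRange
    continuous_quotient_mk'

/-- Every function which extends continuously to some group compactification has a continuous
aperiodic realization, on the quotient by the periods of the extension. -/
theorem exists_continuous_isAperiodicRealization (C : GroupCompactification G) {f : C.X → ℂ}
    (hf : Continuous f) :
    ∃ (D : GroupCompactification G) (f' : D.X → ℂ),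
      Continuous f' ∧ D.IsAperiodicRealization f' (f ∘ C.ι) := by
  let D := C.quotient (C.periods f) (C.isClosed_periods hf)
  have hlift : ∀ a b : C.X, (QuotientAddGroup.leftRel (C.periods f)) a b → f a = f b := by
    intro a b hab
    -- Being in the same coset means that `-a + b` is a period; it is applied at `a`.
    have h : ∀ y, f (-a + b + y) = f y := QuotientAddGroup.leftRel_apply.mp hab
    rw [← h a, add_right_comm, neg_add_cancel, zero_add]
  let f' : D.X → ℂ := Quotient.lift f hlift
  have hf' : Continuous f' := hf.quotient_lift hlift
  refine ⟨D, f', hf', ⟨D.riemannIntegrable_of_continuous hf', rfl⟩, ?_⟩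
  ext x
  rw [Set.mem_ofPred_eq, D.transDist_eq_zero_iff hf', Set.mem_singleton_iff]
  refine ⟨fun hx => ?_, fun hx y => by rw [hx, zero_add]⟩
  obtain ⟨a, rfl⟩ := QuotientAddGroup.mk_surjective (s := C.periods f) x
  -- At the class of `y`, `hx` unfolds to `f (a + y) = f y`, so `a` is a period of `f`.
  exact (QuotientAddGroup.eq_zero_iff a).mpr fun y =>
    hx (QuotientAddGroup.mk (s := C.periods f) y)

end GroupCompactification

theorem mainTheorem5 {G : Type u} [AddCommGroup G] [TopologicalSpace G]
    [IsTopologicalAddGroup G] [LocallyCompactSpace G] [T2Space G]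
    (φ : G → ℂ) (hφ : IsAlmostPeriodic φ) :
    ∃ (C : GroupCompactification G) (f : C.X → ℂ),
      Continuous f ∧ C.IsAperiodicRealization f φ := by
  obtain ⟨f, hf, rfl⟩ := hφ
  exact (bohrCompactification G).exists_continuous_isAperiodicRealization hf
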